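/- **Corollary (Scaling from the omni-directional reception case).** Let $\Phi=\{x_i\}_{i\in\mathbb N}$ be a homogeneous Poisson point process on $\mathbb R^2$ with intensity $\lambda>0$, let $\alpha>2$, and let the channel gains $h_i$ be i.i.d. copies of a random variable $h>0$ with $E[h]<\infty$, independent of $\Phi$. A receiver is located at $0$ (or, more generally, at any fixed point, which then replaces $0$ below), and node $i$ produces there the interference power $h_i\|x_i\|^{-\alpha}$. Let $0<\phi\le 2\pi$ and let $I_1\ge I_2\ge\cdots$ be the interference powers, in descending order, of those nodes $x_i$ whose angle in $[0,2\pi)$ with respect to the horizontal axis is at most $\phi$. Let $n\ge 1$ be an integer with $n+1>\alpha/2$, and let $\mathcal I(n)=\sum_{k=n+1}^{\infty} I_k$ be the partial accumulative interference under directional reception with angle $\phi$. For $R>0$ let $\mathcal I_{\Phi\setminus B_0(R)}=\sum_{x_i\in\Phi\setminus B_0(R)}h_i\|x_i\|^{-\alpha}$ be the omni-directional interference from the nodes outside the disc $B_0(R)$ of radius $R$ around $0$. Then, for every $R>0$, $$E\big[\mathcal I_{\Phi\setminus B_0(R)}\big]=2\pi\lambda\,E[h]\,\frac{R^{2-\alpha}}{\alpha-2},$$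 and $$E[\mathcal I(n)]=E\big[\mathcal I_{\Phi\setminus B_0(R)}\big]\quad\text{for}\quad R=\left(\frac{\phi\,E[h^{2/\alpha}]}{2}\right)^{\frac{\alpha}{2(2-\alpha)}}\left(\frac{(n)_{1-\alpha/2}}{\pi\,E[h]}\right)^{\frac1{2-\alpha}}\lambda^{-1/2},$$ where $(n)_{1-\alpha/2}=\Gamma(n+1-\alpha/2)/\Gamma(n)$; this $R$ is positive. -/

import Mathlib

open MeasureTheory ProbabilityTheory
open scoped ENNReal NNReal

noncomputable section

/-- The Euclidean plane, in which the nodes of the network live. -/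
abbrev Plane : Type := EuclideanSpace ℝ (Fin 2)

/-- The number of points of the family `(x i)` lying in `B`, as an extended natural number. -/
def pointCount (x : ℕ → Plane) (B : Set Plane) : ℕ∞ :=
  {i : ℕ | x i ∈ B}.encard

/-- The random points `X 0, X 1, …` (in an arbitrary measurable enumeration) form a homogeneous
Poisson point process on the plane with intensity `lam`: the number of points in a Borel set `B`
of finite area is Poisson distributed with mean `lam * area B`, and the numbers of points in
pairwise disjoint Borel sets are independent. -/
structure IsHomogeneousPoissonProcess {Ω : Type*} [MeasurableSpace Ω] (P : Measure Ω)
    (X : ℕ → Ω → Plane) (lam : ℝ) : Prop where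
  measurable : ∀ i, Measurable (X i)
  poisson : ∀ B : Set Plane, MeasurableSet B → volume B < ∞ → ∀ k : ℕ,
    P {ω | pointCount (fun i => X i ω) B = (k : ℕ∞)} =
      poissonMeasure (lam.toNNReal * (volume B).toNNReal) {k}
  indep : ∀ (m : ℕ) (B : Fin m → Set Plane), (∀ j, MeasurableSet (B j)) →
    Pairwise (fun j l => Disjoint (B j) (B l)) →
    iIndepFun (fun j ω => pointCount (fun i => X i ω) (B j)) P

/-- The channel gains `h i` are independent with common law `ν`, and the whole sequence of gains
is independent of the sequence of node positions. -/
structure IsChannelGain {Ω : Type*} [MeasurableSpace Ω] (P : Measure Ω)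
    (X : ℕ → Ω → Plane) (h : ℕ → Ω → ℝ) (ν : Measure ℝ) : Prop where
  measurable : ∀ i, Measurable (h i)
  law : ∀ i, P.map (h i) = ν
  indep : iIndepFun h P
  indep_nodes : IndepFun (fun ω i => X i ω) (fun ω i => h i ω) P

/-- The angle of the vector `v` with respect to the horizontal axis, in `[0, 2π)`
(equal to `0` for `v = 0`). -/
def polarAngle (v : Plane) : ℝ :=
  toIcoMod Real.two_pi_pos 0 (Complex.arg ⟨v 0, v 1⟩)

/-- The interference power `g * ‖rx - y‖ ^ (-α)` received at `rx` from a node at `y` with channel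
gain `g`. -/
def interferencePower (α : ℝ) (rx y : Plane) (g : ℝ) : ℝ≥0∞ :=
  ENNReal.ofReal (g * ‖rx - y‖ ^ (-α))

/-- The indices of the nodes received at `rx` with reception angle `φ`. -/
def directionalNodes (φ : ℝ) (rx : Plane) (x : ℕ → Plane) : Set ℕ :=
  {i | polarAngle (x i - rx) ≤ φ}

/-- The `k`-th largest value (`k = 1, 2, …`, counted with multiplicity) of the family `a` on the
index set `S`: the largest level that is reached by at least `k` indices of `S`. -/
def kthLargest (S : Set ℕ) (a : ℕ → ℝ≥0∞) (k : ℕ) : ℝ≥0∞ :=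
  sSup {t : ℝ≥0∞ | (k : ℕ∞) ≤ {i ∈ S | t ≤ a i}.encard}

/-- The `k`-th dominant interference power under directional reception with angle `φ`, for nodes
`x i` with channel gains `g i`. -/
def dominantInterference (α φ : ℝ) (rx : Plane) (x : ℕ → Plane) (g : ℕ → ℝ) (k : ℕ) : ℝ≥0∞ :=
  kthLargest (directionalNodes φ rx x) (fun i => interferencePower α rx (x i) (g i)) k

/-- The partial accumulative interference under directional reception: the sum of the `k`-th
dominant interference powers over all `k ≥ n + 1`. -/
def partialInterference (α φ : ℝ) (rx : Plane) (n : ℕ) (x : ℕ → Plane) (g : ℕ → ℝ) : ℝ≥0∞ :=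
  ∑' k : ℕ, dominantInterference α φ rx x g (n + 1 + k)

open Classical in
/-- The omni-directional accumulative interference at `rx` from all the nodes outside the disc of
radius `R` around `rx`. -/
def outsideInterference (α : ℝ) (rx : Plane) (R : ℝ) (x : ℕ → Plane) (g : ℕ → ℝ) : ℝ≥0∞ :=
  ∑' i : ℕ, if x i ∈ Metric.ball rx R then 0 else interferencePower α rx (x i) (g i)

/-- The Pochhammer symbol `(n)_s = Γ(n + s) / Γ(n)` with a real index `s`. -/
def realPochhammer (n : ℕ) (s : ℝ) : ℝ :=
  Real.Gamma (n + s) / Real.Gamma n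

/-- The moment `E[h ^ s]` of a channel gain with law `ν`. -/
def gainMoment (ν : Measure ℝ) (s : ℝ) : ℝ :=
  ∫ t, t ^ s ∂ν

/-- The radius
`R = (φ E[h^(2/α)] / 2)^(α / (2(2-α))) ((n)_{1-α/2} / (π E[h]))^(1/(2-α)) lam^(-1/2)`. -/
def equivalentRadius (α φ lam : ℝ) (ν : Measure ℝ) (n : ℕ) : ℝ :=
  (φ * gainMoment ν (2 / α) / 2) ^ (α / (2 * (2 - α))) *
    (realPochhammer n (1 - α / 2) / (Real.pi * ∫ t, t ∂ν)) ^ (1 / (2 - α)) *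
    lam ^ (-(1 / 2) : ℝ)

end

/-!
The Laplace functional of a Poisson process determines the Poisson law of the number of points in a
set, hence Campbell's formula for the mean of a sum over the points. Integrating out independent
gains in it shows that the pairs of a node and its gain form a Poisson process on `Plane × ℝ`, with
intensity the product of the intensity of the nodes and the law of the gains.

Campbell's formula and polar coordinates give the mean interference from outside a disc. For the
directional side, the number of nodes received with power at least `t` is Poisson with mean
`c t ^ (-2/α)`, where `c = lam φ E[h ^ (2/α)] / 2`. So the `k`-th dominant power has the law of
`c ^ (α/2) Γₖ ^ (-α/2)`, with `Γₖ` a gamma variable of shape `k`, and mean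
`c ^ (α/2) Γ(k - α/2) / Γ(k)`. Writing these ratios as Beta integrals turns the sum over `k > n`
into a geometric series, with value `c ^ (α/2) (n)_{1-α/2} / (α/2 - 1)`; the equivalent radius
equates this with the mean interference from outside the disc.
-/

section Counting

lemma measurable_encard_setOf {Ω : Type*} [MeasurableSpace Ω] {p : ℕ → Ω → Prop}
    (hp : ∀ i, MeasurableSet {ω | p i ω}) : Measurable fun ω => {i | p i ω}.encard :=
  measurable_encard.comp (measurable_set_iff.2 fun i => measurableSet_setOfPred.1 (hp i))

lemma tsum_indicator_eq_mul_encard {E : Type*} (x : ℕ → E) (A : Set E) (c : ℝ≥0∞) :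
    ∑' i, A.indicator (fun _ => c) (x i) = c * {i | x i ∈ A}.encard := by
  rw [← ENNReal.tsum_set_one, ← ENNReal.tsum_mul_left, tsum_subtype {i | x i ∈ A} fun _ => c * 1]
  simp only [mul_one]
  rfl

end Counting

/-- The function `x ↦ e^(-x)` from `[0, ∞]` to `[0, 1]`, with `e^(-∞) = 0`. -/
noncomputable def expNeg (x : ℝ≥0∞) : ℝ≥0∞ :=
  (-(x : EReal)).exp

section ExpNeg

lemma expNeg_zero : expNeg 0 = 1 := by
  simp [expNeg]

lemma expNeg_eq_zero_iff {x : ℝ≥0∞} : expNeg x = 0 ↔ x = ∞ := by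
  simp [expNeg]

lemma expNeg_ofReal {x : ℝ} (hx : 0 ≤ x) :
    expNeg (ENNReal.ofReal x) = ENNReal.ofReal (Real.exp (-x)) := by
  rw [expNeg, EReal.coe_ennreal_ofReal, max_eq_left hx, ← EReal.coe_neg, EReal.exp_coe]

lemma expNeg_strictAnti : StrictAnti expNeg := fun _ _ hxy =>
  EReal.exp_strictMono (EReal.neg_lt_neg_iff.2 (EReal.coe_ennreal_lt_coe_ennreal_iff.2 hxy))

lemma expNeg_le_one (x : ℝ≥0∞) : expNeg x ≤ 1 :=
  expNeg_zero ▸ expNeg_strictAnti.antitone (zero_le (a := x))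

lemma expNeg_ne_top (x : ℝ≥0∞) : expNeg x ≠ ∞ :=
  ne_top_of_le_ne_top ENNReal.one_ne_top (expNeg_le_one x)

lemma continuous_expNeg : Continuous expNeg :=
  ENNReal.continuous_exp.comp (continuous_neg.comp continuous_coe_ennreal_ereal)

lemma measurable_expNeg : Measurable expNeg :=
  continuous_expNeg.measurable

lemma expNeg_add (x y : ℝ≥0∞) : expNeg (x + y) = expNeg x * expNeg y := by
  rw [expNeg, expNeg, expNeg, EReal.coe_ennreal_add,
    EReal.neg_add (.inl (EReal.coe_ennreal_ne_bot x)) (.inr (EReal.coe_ennreal_ne_bot y)),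
    sub_eq_add_neg, EReal.exp_add]

lemma expNeg_sum {ι : Type*} (s : Finset ι) (f : ι → ℝ≥0∞) :
    expNeg (∑ i ∈ s, f i) = ∏ i ∈ s, expNeg (f i) := by
  classical
  induction s using Finset.induction_on with
  | empty => simp [expNeg_zero]
  | insert i s hi ih => rw [Finset.sum_insert hi, Finset.prod_insert hi, expNeg_add, ih]

lemma expNeg_mul_natCast (x : ℝ≥0∞) (k : ℕ) : expNeg (x * k) = expNeg x ^ k := by
  simpa [mul_comm] using expNeg_sum (Finset.range k) fun _ => x

lemma expNeg_iSup (u : ℕ → ℝ≥0∞) : expNeg (⨆ m, u m) = ⨅ m, expNeg (u m) :=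
  expNeg_strictAnti.antitone.map_ciSup_of_continuousAt continuous_expNeg.continuousAt
    (OrderTop.bddAbove _)

lemma expNeg_tsum (u : ℕ → ℝ≥0∞) :
    expNeg (∑' i, u i) = ⨅ m, ∏ i ∈ Finset.range m, expNeg (u i) := by
  simp only [ENNReal.tsum_eq_iSup_nat, expNeg_iSup, expNeg_sum]

/-- The inverse `y ↦ -log y` of `expNeg` on `[0, 1]`. -/
noncomputable def negLog (y : ℝ≥0∞) : ℝ≥0∞ :=
  (-ENNReal.log y).toENNReal

lemma measurable_negLog : Measurable negLog :=
  (ENNReal.measurable_log.neg).ereal_toENNReal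

lemma expNeg_negLog {y : ℝ≥0∞} (hy : y ≤ 1) : expNeg (negLog y) = y := by
  have hlog : 0 ≤ -ENNReal.log y := by simpa using hy
  rw [expNeg, negLog, EReal.coe_toENNReal hlog, neg_neg, ENNReal.exp_log]

end ExpNeg

section PoissonLaw

lemma head_le_of_tsum_mul_pow_le {a b : ℕ → ℝ≥0∞} (hb : ∑' k, b k ≠ ∞)
    (hab : ∀ z : ℝ≥0∞, 0 < z → z < 1 → ∑' k, a k * z ^ k ≤ ∑' k, b k * z ^ k) : a 0 ≤ b 0 := by
  have bound : ∀ z : ℝ≥0∞, 0 < z → z < 1 → a 0 ≤ b 0 + z * ∑' k, b k := by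
    intro z hz hz'
    calc a 0 = a 0 * z ^ 0 := by rw [pow_zero, mul_one]
      _ ≤ ∑' k, a k * z ^ k := ENNReal.le_tsum 0
      _ ≤ ∑' k, b k * z ^ k := hab z hz hz'
      _ = b 0 + ∑' k, b (k + 1) * z ^ (k + 1) := by
        rw [tsum_eq_zero_add' ENNReal.summable, pow_zero, mul_one]
      _ ≤ b 0 + ∑' k, z * b (k + 1) := by
        gcongr b 0 + ∑' k, ?_ with k
        rw [mul_comm, pow_succ']
        gcongr
        exact mul_le_of_le_one_right' (pow_le_one' hz'.le k)
      _ ≤ b 0 + z * ∑' k, b k := by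
        rw [ENNReal.tsum_mul_left]
        gcongr b 0 + z * ?_
        exact ENNReal.tsum_comp_le_tsum_of_injective Nat.succ_injective b
  have tendsto_bound : Filter.Tendsto (fun z => b 0 + z * ∑' k, b k) (nhdsWithin 0 (Set.Ioi 0))
      (nhds (b 0)) := by
    have : Continuous fun z : ℝ≥0∞ => b 0 + z * ∑' k, b k :=
      continuous_const.add (ENNReal.continuous_mul_const hb)
    simpa using (this.tendsto 0).mono_left nhdsWithin_le_nhds
  refine ge_of_tendsto tendsto_bound ?_
  filter_upwards [Ioo_mem_nhdsGT zero_lt_one] with z hz using bound z hz.1 hz.2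

lemma eq_of_tsum_mul_pow_eq {a b : ℕ → ℝ≥0∞} (ha : ∑' k, a k ≠ ∞) (hb : ∑' k, b k ≠ ∞)
    (hab : ∀ z : ℝ≥0∞, 0 < z → z < 1 → ∑' k, a k * z ^ k = ∑' k, b k * z ^ k) (k : ℕ) :
    a k = b k := by
  have head_eq : a 0 = b 0 := le_antisymm
    (head_le_of_tsum_mul_pow_le hb fun z hz hz' => (hab z hz hz').le)
    (head_le_of_tsum_mul_pow_le ha fun z hz hz' => (hab z hz hz').ge)
  induction k generalizing a b with
  | zero => exact head_eq
  | succ _ ih =>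
    have tail_ne_top {c : ℕ → ℝ≥0∞} (hc : ∑' k, c k ≠ ∞) : ∑' k, c (k + 1) ≠ ∞ :=
      ne_top_of_le_ne_top hc (ENNReal.tsum_comp_le_tsum_of_injective Nat.succ_injective c)
    have tail_eq : ∀ z : ℝ≥0∞, 0 < z → z < 1 →
        ∑' k, a (k + 1) * z ^ k = ∑' k, b (k + 1) * z ^ k := by
      intro z hz hz'
      have := hab z hz hz'
      rw [tsum_eq_zero_add' (f := fun k => a k * z ^ k) ENNReal.summable,
        tsum_eq_zero_add' (f := fun k => b k * z ^ k) ENNReal.summable, head_eq,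
        ENNReal.add_right_inj (by simpa using ENNReal.ne_top_of_tsum_ne_top hb 0)] at this
      simp only [pow_succ, ← mul_assoc, ENNReal.tsum_mul_right] at this
      exact (ENNReal.mul_left_inj hz.ne' hz'.ne_top).1 this
    refine ih (tail_ne_top ha) (tail_ne_top hb) tail_eq ?_
    exact le_antisymm
      (head_le_of_tsum_mul_pow_le (tail_ne_top hb) fun z hz hz' => (tail_eq z hz hz').le)
      (head_le_of_tsum_mul_pow_le (tail_ne_top ha) fun z hz hz' => (tail_eq z hz hz').ge)

lemma ext_of_natCast_singleton {μ μ' : Measure ℕ∞} [IsProbabilityMeasure μ]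
    [IsProbabilityMeasure μ'] (h : ∀ k : ℕ, μ {(k : ℕ∞)} = μ' {(k : ℕ∞)}) : μ = μ' := by
  have singleton_top : ({⊤} : Set ℕ∞) = (⋃ k : ℕ, {(k : ℕ∞)})ᶜ := by
    ext a
    induction a using ENat.recTopCoe <;> simp
  have disjoint : Pairwise (Function.onFun Disjoint fun k : ℕ => ({(k : ℕ∞)} : Set ℕ∞)) :=
    fun i j hij => by simpa [Function.onFun] using hij
  refine Measure.ext_iff_singleton.2 fun a => ?_
  induction a using ENat.recTopCoe with
  | coe k => exact h k
  | top =>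
    simp only [singleton_top, prob_compl_eq_one_sub MeasurableSet.of_discrete,
      measure_iUnion disjoint fun _ => MeasurableSet.of_discrete, h]

lemma lintegral_expNeg_mul (μ : Measure ℕ∞) {s : ℝ≥0∞} (hs : s ≠ 0) :
    ∫⁻ k, expNeg (s * k) ∂μ = ∑' k : ℕ, μ {(k : ℕ∞)} * expNeg s ^ k := by
  rw [lintegral_countable', ← (Nat.cast_injective (R := ℕ∞)).tsum_eq]
  · simp only [ENat.toENNReal_coe, expNeg_mul_natCast, mul_comm]
  · intro a ha
    induction a using ENat.recTopCoe with
    | coe k => exact ⟨k, rfl⟩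
    | top => simp [ENNReal.mul_top hs, expNeg_eq_zero_iff.2] at ha

lemma ext_of_lintegral_expNeg {μ μ' : Measure ℕ∞} [IsProbabilityMeasure μ]
    [IsProbabilityMeasure μ']
    (h : ∀ s : ℝ≥0∞, ∫⁻ k, expNeg (s * k) ∂μ = ∫⁻ k, expNeg (s * k) ∂μ') : μ = μ' := by
  have summable (ρ : Measure ℕ∞) [IsProbabilityMeasure ρ] : ∑' k : ℕ, ρ {(k : ℕ∞)} ≠ ∞ :=
    ne_top_of_le_ne_top (measure_ne_top ρ Set.univ) <|
      tsum_meas_le_meas_iUnion_of_disjoint ρ (fun _ => .of_discrete)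
        (fun i j hij => by simpa [Function.onFun] using hij) |>.trans
          (measure_mono (Set.subset_univ _))
  refine ext_of_natCast_singleton (eq_of_tsum_mul_pow_eq (summable μ) (summable μ') ?_)
  intro z _ hz
  have hs : negLog z ≠ 0 := fun h0 => hz.ne (by rw [← expNeg_negLog hz.le, h0, expNeg_zero])
  simpa only [lintegral_expNeg_mul _ hs, expNeg_negLog hz.le] using h (negLog z)

lemma lintegral_expNeg_mul_poissonMeasure (r : ℝ≥0) (s : ℝ≥0∞) :
    ∫⁻ k, expNeg (s * k) ∂poissonMeasure r = expNeg ((1 - expNeg s) * r) := by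
  obtain ⟨z, hz⟩ : ∃ z : ℝ≥0, z = expNeg s := ⟨_, ENNReal.coe_toNNReal (expNeg_ne_top s)⟩
  have hz1 : z ≤ 1 := by exact_mod_cast hz.trans_le (expNeg_le_one s)
  have hasSum_pgf : HasSum (fun k : ℕ => Real.exp (-r) * r ^ k / k.factorial * z ^ k)
      (Real.exp (-((1 - z) * r))) := by
    convert! (NormedSpace.expSeries_div_hasSum_exp (r * z : ℝ)).mul_left (Real.exp (-r)) using 1
    · ext k; rw [mul_pow]; ring
    · rw [← Real.exp_eq_exp_ℝ, ← Real.exp_add]; ring_nf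
  have hz1' : (0 : ℝ) ≤ 1 - z := sub_nonneg.2 hz1
  have rhs_eq : (1 - expNeg s) * r = ENNReal.ofReal ((1 - z) * r) := by
    rw [ENNReal.ofReal_mul hz1', ENNReal.ofReal_sub _ z.coe_nonneg, ← hz]
    simp
  rw [rhs_eq, expNeg_ofReal (mul_nonneg hz1' r.coe_nonneg), ← hasSum_pgf.tsum_eq,
    ENNReal.ofReal_tsum_of_nonneg (fun k => by positivity) hasSum_pgf.summable,
    lintegral_countable']
  refine tsum_congr fun k => ?_
  rw [expNeg_mul_natCast, poissonMeasure_singleton, ENNReal.ofReal_mul (by positivity),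
    ENNReal.ofReal_pow z.coe_nonneg, ← hz, ENNReal.ofReal_coe_nnreal, mul_comm]

lemma lintegral_natCast_poissonMeasure (r : ℝ≥0) :
    ∫⁻ k, (k : ℝ≥0∞) ∂poissonMeasure r = r := by
  have succ_mul (k : ℕ) :
      ((k + 1 : ℕ) : ℝ≥0∞) * poissonMeasure r {k + 1} = r * poissonMeasure r {k} := by
    rw [poissonMeasure_singleton, poissonMeasure_singleton, ← ENNReal.ofReal_natCast,
      ← ENNReal.ofReal_coe_nnreal, ← ENNReal.ofReal_mul (by positivity),
      ← ENNReal.ofReal_mul (by positivity), Nat.factorial_succ]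
    congr 1
    push_cast
    field_simp
    ring
  rw [lintegral_countable', tsum_eq_zero_add' ENNReal.summable, Nat.cast_zero, zero_mul, zero_add]
  simp only [succ_mul, ENNReal.tsum_mul_left]
  have : ∑' k, poissonMeasure r {k} = 1 := by
    rw [← measure_univ (μ := poissonMeasure r), ← lintegral_one, lintegral_countable']
    simp only [one_mul]
  rw [this, mul_one]

end PoissonLaw

section PoissonProcess

variable {Ω E : Type*} [MeasurableSpace Ω] [MeasurableSpace E]

/-- The random points `X 0, X 1, …` form a Poisson point process on `E` with intensity measure `μ`:
the number of points in a measurable set `B` with `μ B < ∞` is Poisson distributed with mean `μ B`,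
and the numbers of points in finitely many pairwise disjoint measurable sets are independent. -/
structure IsPoissonProcess (P : Measure Ω) (X : ℕ → Ω → E) (μ : Measure E) : Prop where
  measurable : ∀ i, Measurable (X i)
  map_encard : ∀ B, MeasurableSet B → μ B < ∞ → P.map (fun ω => {i | X i ω ∈ B}.encard) =
    (poissonMeasure (μ B).toNNReal).map ((↑) : ℕ → ℕ∞)
  indep : ∀ {ι : Type} [Finite ι] (B : ι → Set E), (∀ j, MeasurableSet (B j)) →
    Pairwise (fun j l => Disjoint (B j) (B l)) →
    iIndepFun (fun j ω => {i | X i ω ∈ B j}.encard) P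

/-- The Laplace functional `f ↦ E[exp (-∑ᵢ f (X i))]` of the random points `X 0, X 1, …` is that of
a Poisson point process with intensity measure `μ`. Unlike the independence of the counts, this
form of the Poisson property passes to marked points directly. -/
structure HasPoissonLaplace (P : Measure Ω) (X : ℕ → Ω → E) (μ : Measure E) : Prop where
  measurable : ∀ i, Measurable (X i)
  lintegral_expNeg_tsum : ∀ f : E → ℝ≥0∞, Measurable f →
    ∫⁻ ω, expNeg (∑' i, f (X i ω)) ∂P = expNeg (∫⁻ x, (1 - expNeg (f x)) ∂μ)

variable {P : Measure Ω} {X : ℕ → Ω → E} {μ : Measure E}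

lemma lintegral_expNeg_mul_of_map_eq_poissonMeasure {N : Ω → ℕ∞} {r : ℝ≥0} (hN : Measurable N)
    (h : P.map N = (poissonMeasure r).map ((↑) : ℕ → ℕ∞)) (s : ℝ≥0∞) :
    ∫⁻ ω, expNeg (s * N ω) ∂P = expNeg ((1 - expNeg s) * r) := by
  rw [← lintegral_map (f := fun k : ℕ∞ => expNeg (s * k)) .of_discrete hN, h,
    lintegral_map .of_discrete .of_discrete]
  exact lintegral_expNeg_mul_poissonMeasure r s

lemma tsum_simpleFunc_eq_sum_mul_encard (f : SimpleFunc E ℝ≥0∞) (x : ℕ → E) :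
    ∑' i, f (x i) =
      ∑ c : f.range.filter (· ≠ 0), (c : ℝ≥0∞) * {i | x i ∈ f ⁻¹' {(c : ℝ≥0∞)}}.encard := by
  have sum_indicator (y : E) :
      f y = ∑ c ∈ f.range.filter (· ≠ 0), (f ⁻¹' {c}).indicator (fun _ => c) y := by
    classical
    simp only [Set.indicator_apply, Set.mem_preimage, Set.mem_singleton_iff, Finset.sum_ite_eq,
      Finset.mem_filter, SimpleFunc.mem_range_self, true_and, ite_not]
    split_ifs with hy
    exacts [hy, rfl]
  rw [Finset.sum_coe_sort (f.range.filter (· ≠ 0)) fun c => c * {i | x i ∈ f ⁻¹' {c}}.encard]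
  simp only [← tsum_indicator_eq_mul_encard]
  rw [← Summable.tsum_finsetSum fun _ _ => ENNReal.summable]
  exact tsum_congr fun i => sum_indicator (x i)

namespace IsPoissonProcess

lemma measurable_encard (hX : IsPoissonProcess P X μ) {B : Set E} (hB : MeasurableSet B) :
    Measurable fun ω => {i | X i ω ∈ B}.encard :=
  measurable_encard_setOf fun i => hX.measurable i hB

lemma lintegral_expNeg_tsum_simpleFunc (hX : IsPoissonProcess P X μ) (f : SimpleFunc E ℝ≥0∞)
    (hf : f.FinMeasSupp μ) :
    ∫⁻ ω, expNeg (∑' i, f (X i ω)) ∂P = expNeg (∫⁻ x, (1 - expNeg (f x)) ∂μ) := by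
  let levels := f.range.filter (· ≠ 0)
  let N (c : levels) (ω : Ω) : ℕ∞ := {i | X i ω ∈ f ⁻¹' {(c : ℝ≥0∞)}}.encard
  have measure_level (c : levels) : μ (f ⁻¹' {(c : ℝ≥0∞)}) < ∞ :=
    SimpleFunc.finMeasSupp_iff.1 hf _ (Finset.mem_filter.1 c.2).2
  have measurable_N (c : levels) : Measurable (N c) :=
    hX.measurable_encard (f.measurableSet_fiber _)
  have indep_N : iIndepFun N P := hX.indep _ (fun c => f.measurableSet_fiber _) fun c d hcd =>
    (Set.disjoint_singleton.2 (Subtype.coe_injective.ne hcd)).preimage f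
  have measurable_exp (c : levels) : Measurable fun k : ℕ∞ => expNeg (c * k) := .of_discrete
  calc ∫⁻ ω, expNeg (∑' i, f (X i ω)) ∂P
      = ∫⁻ ω, ∏ c, expNeg (c * N c ω) ∂P := by
        simp only [tsum_simpleFunc_eq_sum_mul_encard, expNeg_sum, N, levels]
    _ = ∏ c : levels, ∫⁻ ω, expNeg (c * N c ω) ∂P :=
        lintegral_prod_eq_prod_lintegral_of_indepFun _ _ (indep_N.comp _ measurable_exp)
          fun c => (measurable_exp c).comp (measurable_N c)
    _ = ∏ c : levels, expNeg ((1 - expNeg c) * μ (f ⁻¹' {(c : ℝ≥0∞)})) := by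
        refine Finset.prod_congr rfl fun c _ => ?_
        rw [lintegral_expNeg_mul_of_map_eq_poissonMeasure (measurable_N c)
          (hX.map_encard _ (f.measurableSet_fiber _) (measure_level c)),
          ENNReal.coe_toNNReal (measure_level c).ne]
    _ = expNeg ((f.map fun c => 1 - expNeg c).lintegral μ) := by
        rw [← expNeg_sum, SimpleFunc.map_lintegral, Finset.sum_coe_sort levels fun c =>
          (1 - expNeg c) * μ (f ⁻¹' {c}), Finset.sum_filter_of_ne]
        rintro c - hc rfl
        simp [expNeg_zero] at hc
    _ = expNeg (∫⁻ x, (1 - expNeg (f x)) ∂μ) := by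
        rw [← SimpleFunc.lintegral_eq_lintegral]
        rfl

end IsPoissonProcess

lemma exists_finMeasSupp_iSup_eq [SigmaFinite μ] {f : E → ℝ≥0∞} (hf : Measurable f) :
    ∃ g : ℕ → SimpleFunc E ℝ≥0∞,
      (∀ k, (g k).FinMeasSupp μ) ∧ Monotone g ∧ ∀ x, ⨆ k, g k x = f x := by
  have hS := measurableSet_spanningSets μ
  have apply_eq (k : ℕ) (x : E) : ((SimpleFunc.eapprox f k).restrict (spanningSets μ k)) x =
      (spanningSets μ k).indicator (SimpleFunc.eapprox f k) x :=
    SimpleFunc.restrict_apply _ (hS k) x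
  refine ⟨fun k => (SimpleFunc.eapprox f k).restrict (spanningSets μ k), fun k => ?_,
    fun k l hkl x => ?_, fun x => ?_⟩
  · refine SimpleFunc.finMeasSupp_iff_support.2
      ((measure_mono fun x hx => ?_).trans_lt (measure_spanningSets_lt_top μ k))
    rw [Function.mem_support, apply_eq] at hx
    exact Set.mem_of_indicator_ne_zero hx
  · rw [apply_eq, apply_eq]
    exact (Set.indicator_le_indicator_of_subset (monotone_spanningSets μ hkl)
      (fun _ => zero_le) x).trans (Set.indicator_le_indicator (SimpleFunc.monotone_eapprox f hkl x))
  · simp only [apply_eq, ← SimpleFunc.iSup_eapprox_apply hf x]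
    refine le_antisymm (iSup_mono fun k => Set.indicator_le_self _ _ x) (iSup_le fun k => ?_)
    have hx : x ∈ spanningSets μ (max k (spanningSetsIndex μ x)) :=
      monotone_spanningSets μ (le_max_right _ _) (mem_spanningSetsIndex μ x)
    refine le_iSup_of_le (max k (spanningSetsIndex μ x)) ?_
    rw [Set.indicator_of_mem hx]
    exact SimpleFunc.monotone_eapprox f (le_max_left _ _) x

lemma tsum_iSup_of_monotone {u : ℕ → ℕ → ℝ≥0∞} (hu : ∀ i, Monotone fun k => u k i) :
    ∑' i, ⨆ k, u k i = ⨆ k, ∑' i, u k i := by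
  simp only [← lintegral_count]
  exact lintegral_iSup (fun _ => .of_discrete) fun k l hkl i => hu i hkl

theorem IsPoissonProcess.hasPoissonLaplace [IsFiniteMeasure P] [SigmaFinite μ]
    (hX : IsPoissonProcess P X μ) : HasPoissonLaplace P X μ := by
  refine ⟨hX.measurable, fun f hf => ?_⟩
  obtain ⟨g, hg, g_mono, iSup_g⟩ := exists_finMeasSupp_iSup_eq (μ := μ) hf
  have measurable_lhs (k : ℕ) : Measurable fun ω => expNeg (∑' i, g k (X i ω)) :=
    measurable_expNeg.comp (Measurable.tsum fun i => (g k).measurable.comp (hX.measurable i))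
  have antitone_lhs : Antitone fun k ω => expNeg (∑' i, g k (X i ω)) := fun k l hkl ω =>
    expNeg_strictAnti.antitone (ENNReal.tsum_le_tsum fun i => g_mono hkl (X i ω))
  have monotone_rhs : Monotone fun k x => 1 - expNeg (g k x) := fun k l hkl x =>
    tsub_le_tsub_left (expNeg_strictAnti.antitone (g_mono hkl x)) 1
  calc ∫⁻ ω, expNeg (∑' i, f (X i ω)) ∂P
      = ∫⁻ ω, ⨅ k, expNeg (∑' i, g k (X i ω)) ∂P := by
        simp only [← iSup_g, ← expNeg_iSup]
        congr! 3 with ω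
        exact tsum_iSup_of_monotone fun i k l hkl => g_mono hkl (X i ω)
    _ = ⨅ k, ∫⁻ ω, expNeg (∑' i, g k (X i ω)) ∂P :=
        lintegral_iInf measurable_lhs antitone_lhs
          (ne_top_of_le_ne_top (measure_ne_top P Set.univ) (by
            simpa using lintegral_mono fun ω => expNeg_le_one (∑' i, g 0 (X i ω))))
    _ = expNeg (⨆ k, ∫⁻ x, (1 - expNeg (g k x)) ∂μ) := by
        simp only [fun k => hX.lintegral_expNeg_tsum_simpleFunc (g k) (hg k), expNeg_iSup]
    _ = expNeg (∫⁻ x, (1 - expNeg (f x)) ∂μ) := by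
        rw [← lintegral_iSup (f := fun k x => 1 - expNeg (g k x))
          (fun k => (measurable_expNeg.comp (g k).measurable).const_sub 1) monotone_rhs]
        simp only [← iSup_g, expNeg_iSup, ENNReal.sub_iInf]

end PoissonProcess

section PoissonLaplace

variable {Ω E M : Type*} [MeasurableSpace Ω] [MeasurableSpace E] [MeasurableSpace M]
  {P : Measure Ω} {X : ℕ → Ω → E} {h : ℕ → Ω → M} {μ : Measure E} {ν : Measure M}

lemma lintegral_expNeg_tsum_eq_iInf [IsFiniteMeasure P] {u : ℕ → Ω → ℝ≥0∞}
    (hu : ∀ i, Measurable (u i)) :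
    ∫⁻ ω, expNeg (∑' i, u i ω) ∂P = ⨅ m, ∫⁻ ω, ∏ i ∈ Finset.range m, expNeg (u i ω) ∂P := by
  simp only [expNeg_tsum]
  refine lintegral_iInf
    (fun m => Finset.measurable_fun_prod _ fun i _ => measurable_expNeg.comp (hu i))
    (fun m l hml ω => ?_) (by simp)
  exact Finset.prod_le_prod_of_subset_of_le_one' (Finset.range_subset_range.2 hml)
    fun i _ _ => expNeg_le_one _

lemma lintegral_comp_prodMk_of_indepFun [IsFiniteMeasure P] {A B : Type*} [MeasurableSpace A]
    [MeasurableSpace B] {U : Ω → A} {V : Ω → B} (hU : Measurable U) (hV : Measurable V)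
    (hUV : IndepFun U V P) {F : A → B → ℝ≥0∞} (hF : Measurable (Function.uncurry F)) :
    ∫⁻ ω, F (U ω) (V ω) ∂P = ∫⁻ ω, ∫⁻ ω', F (U ω) (V ω') ∂P ∂P := by
  calc ∫⁻ ω, F (U ω) (V ω) ∂P
      = ∫⁻ p, Function.uncurry F p ∂(P.map U).prod (P.map V) := by
        rw [← hUV.map_prod_eq_prod_map_map hU.aemeasurable hV.aemeasurable,
          lintegral_map hF (hU.prodMk hV)]
        rfl
    _ = ∫⁻ ω, ∫⁻ v, F (U ω) v ∂P.map V ∂P := by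
        rw [lintegral_prod _ hF.aemeasurable, lintegral_map hF.lintegral_prod_right' hU]
        rfl
    _ = ∫⁻ ω, ∫⁻ ω', F (U ω) (V ω') ∂P ∂P := lintegral_congr fun ω =>
        lintegral_map (hF.comp measurable_prodMk_left) hV

lemma lintegral_prod_marked [IsFiniteMeasure P] (hX : ∀ i, Measurable (X i))
    (hh : ∀ i, Measurable (h i)) (law : ∀ i, P.map (h i) = ν) (indep : iIndepFun h P)
    (indep_points : IndepFun (fun ω i => X i ω) (fun ω i => h i ω) P) {F : E × M → ℝ≥0∞}
    (hF : Measurable F) (s : Finset ℕ) :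
    ∫⁻ ω, ∏ i ∈ s, F (X i ω, h i ω) ∂P = ∫⁻ ω, ∏ i ∈ s, ∫⁻ g, F (X i ω, g) ∂ν ∂P := by
  rw [lintegral_comp_prodMk_of_indepFun (measurable_pi_lambda _ hX) (measurable_pi_lambda _ hh)
    indep_points (F := fun x g => ∏ i ∈ s, F (x i, g i)) (by fun_prop)]
  refine lintegral_congr fun ω => ?_
  have hFx (i : ℕ) : Measurable fun g => F (X i ω, g) := hF.comp measurable_prodMk_left
  refine (lintegral_prod_eq_prod_lintegral_of_indepFun s (fun i ω' => F (X i ω, h i ω'))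
    (indep.comp _ hFx) fun i => (hFx i).comp (hh i)).trans (Finset.prod_congr rfl fun i _ => ?_)
  rw [← law i, lintegral_map (hFx i) (hh i)]

namespace HasPoissonLaplace

/- Integrating the marks out of `exp (-∑ᵢ f (Xᵢ, hᵢ))` leaves `∏ᵢ ∫ exp (-f (Xᵢ, g)) dν(g)`, which
is again of the form `exp (-∑ᵢ F (Xᵢ))`. -/
theorem marked [IsFiniteMeasure P] [IsProbabilityMeasure ν] (hX : HasPoissonLaplace P X μ)
    (hh : ∀ i, Measurable (h i)) (law : ∀ i, P.map (h i) = ν) (indep : iIndepFun h P)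
    (indep_points : IndepFun (fun ω i => X i ω) (fun ω i => h i ω) P) :
    HasPoissonLaplace P (fun i ω => (X i ω, h i ω)) (μ.prod ν) := by
  have measurable_marked (i : ℕ) : Measurable fun ω => (X i ω, h i ω) :=
    (hX.measurable i).prodMk (hh i)
  refine ⟨measurable_marked, fun f hf => ?_⟩
  have measurable_exp : Measurable fun p => expNeg (f p) := measurable_expNeg.comp hf
  have measurable_exp_right (x : E) : Measurable fun g => expNeg (f (x, g)) :=
    measurable_exp.comp measurable_prodMk_left
  let F (x : E) : ℝ≥0∞ := negLog (∫⁻ g, expNeg (f (x, g)) ∂ν)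
  have measurable_F : Measurable F := measurable_negLog.comp measurable_exp.lintegral_prod_right'
  have mean_le_one (x : E) : ∫⁻ g, expNeg (f (x, g)) ∂ν ≤ 1 :=
    (lintegral_mono fun g => expNeg_le_one _).trans (by simp)
  have expNeg_F (x : E) : expNeg (F x) = ∫⁻ g, expNeg (f (x, g)) ∂ν := expNeg_negLog (mean_le_one x)
  calc ∫⁻ ω, expNeg (∑' i, f (X i ω, h i ω)) ∂P
      = ⨅ m, ∫⁻ ω, ∏ i ∈ Finset.range m, expNeg (f (X i ω, h i ω)) ∂P :=
        lintegral_expNeg_tsum_eq_iInf fun i => hf.comp (measurable_marked i)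
    _ = ⨅ m, ∫⁻ ω, ∏ i ∈ Finset.range m, expNeg (F (X i ω)) ∂P := by
        simp only [expNeg_F, lintegral_prod_marked hX.measurable hh law indep indep_points
          measurable_exp]
    _ = ∫⁻ ω, expNeg (∑' i, F (X i ω)) ∂P :=
        (lintegral_expNeg_tsum_eq_iInf fun i => measurable_F.comp (hX.measurable i)).symm
    _ = expNeg (∫⁻ x, (1 - expNeg (F x)) ∂μ) := hX.lintegral_expNeg_tsum F measurable_F
    _ = expNeg (∫⁻ p, (1 - expNeg (f p)) ∂μ.prod ν) := by
        rw [lintegral_prod _ (measurable_exp.const_sub 1).aemeasurable]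
        congr! 3 with x
        rw [expNeg_F, lintegral_sub (measurable_exp_right x)
          (ne_top_of_le_ne_top ENNReal.one_ne_top (mean_le_one x)) (ae_of_all _ fun _ =>
            expNeg_le_one _), lintegral_one, measure_univ]

lemma measurable_encard (hX : HasPoissonLaplace P X μ) {A : Set E} (hA : MeasurableSet A) :
    Measurable fun ω => {i | X i ω ∈ A}.encard :=
  measurable_encard_setOf fun i => hX.measurable i hA

theorem map_encard [IsProbabilityMeasure P] (hX : HasPoissonLaplace P X μ) {A : Set E}
    (hA : MeasurableSet A) (hμA : μ A ≠ ∞) :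
    P.map (fun ω => {i | X i ω ∈ A}.encard) =
      (poissonMeasure (μ A).toNNReal).map ((↑) : ℕ → ℕ∞) := by
  have := Measure.isProbabilityMeasure_map (hX.measurable_encard hA).aemeasurable (μ := P)
  refine ext_of_lintegral_expNeg fun s => ?_
  have one_sub_expNeg_indicator : (fun x => 1 - expNeg (A.indicator (fun _ => s) x)) =
      A.indicator fun _ => 1 - expNeg s := by
    ext x
    by_cases hx : x ∈ A <;> simp [hx, expNeg_zero]
  calc ∫⁻ k, expNeg (s * k) ∂P.map (fun ω => {i | X i ω ∈ A}.encard)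
      = ∫⁻ ω, expNeg (∑' i, A.indicator (fun _ => s) (X i ω)) ∂P := by
        simp only [tsum_indicator_eq_mul_encard]
        exact lintegral_map (f := fun k : ℕ∞ => expNeg (s * k)) .of_discrete
          (hX.measurable_encard hA)
    _ = expNeg ((1 - expNeg s) * μ A) := by
        rw [hX.lintegral_expNeg_tsum _ (measurable_const.indicator hA), one_sub_expNeg_indicator,
          lintegral_indicator_const hA]
    _ = ∫⁻ k, expNeg (s * k) ∂(poissonMeasure (μ A).toNNReal).map ((↑) : ℕ → ℕ∞) := by
        rw [lintegral_map .of_discrete .of_discrete, ← ENNReal.coe_toNNReal hμA]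
        exact (lintegral_expNeg_mul_poissonMeasure _ s).symm

theorem measure_le_encard [IsProbabilityMeasure P] (hX : HasPoissonLaplace P X μ) {A : Set E}
    (hA : MeasurableSet A) (hμA : μ A ≠ ∞) (k : ℕ) :
    P {ω | (k : ℕ∞) ≤ {i | X i ω ∈ A}.encard} = poissonMeasure (μ A).toNNReal (Set.Ici k) := by
  have cast_preimage : ((↑) : ℕ → ℕ∞) ⁻¹' Set.Ici (k : ℕ∞) = Set.Ici k := by ext; simp
  rw [← cast_preimage, ← Measure.map_apply .of_discrete .of_discrete, ← hX.map_encard hA hμA,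
    Measure.map_apply (hX.measurable_encard hA) .of_discrete]
  rfl

theorem lintegral_tsum [IsProbabilityMeasure P] [SigmaFinite μ] (hX : HasPoissonLaplace P X μ)
    {f : E → ℝ≥0∞} (hf : Measurable f) : ∫⁻ ω, ∑' i, f (X i ω) ∂P = ∫⁻ x, f x ∂μ := by
  have measurable_tsum {f : E → ℝ≥0∞} (hf : Measurable f) :
      Measurable fun ω => ∑' i, f (X i ω) := .tsum fun i => hf.comp (hX.measurable i)
  refine Measurable.ennreal_sigmaFinite_induction (μ := μ)
    (motive := fun f => ∫⁻ ω, ∑' i, f (X i ω) ∂P = ∫⁻ x, f x ∂μ)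
    (fun c A hA hμA => ?_) (fun f g _ hf _ ihf ihg => ?_) (fun f hf f_mono ih => ?_) hf
  · have measurable_cast : Measurable fun k : ℕ∞ => (k : ℝ≥0∞) := .of_discrete
    have measurable_count : Measurable fun ω => ({i | X i ω ∈ A}.encard : ℝ≥0∞) :=
      measurable_cast.comp (hX.measurable_encard hA)
    simp only [tsum_indicator_eq_mul_encard]
    rw [lintegral_const_mul _ measurable_count, lintegral_indicator_const hA,
      ← lintegral_map measurable_cast (hX.measurable_encard hA), hX.map_encard hA hμA.ne,
      lintegral_map measurable_cast .of_discrete]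
    simp only [ENat.toENNReal_coe, lintegral_natCast_poissonMeasure, ENNReal.coe_toNNReal hμA.ne]
  · simp only [Pi.add_apply, ENNReal.tsum_add]
    rw [lintegral_add_left (measurable_tsum hf), lintegral_add_left hf, ihf, ihg]
  · have tsum_iSup (ω : Ω) : ∑' i, ⨆ k, f k (X i ω) = ⨆ k, ∑' i, f k (X i ω) :=
      tsum_iSup_of_monotone fun i k l hkl => f_mono hkl _
    simp only [tsum_iSup]
    rw [lintegral_iSup (fun k => measurable_tsum (hf k)) fun k l hkl ω =>
      ENNReal.tsum_le_tsum fun i => f_mono hkl _, lintegral_iSup hf f_mono]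
    simp only [ih]

end HasPoissonLaplace

end PoissonLaplace

lemma IsHomogeneousPoissonProcess.isPoissonProcess {Ω : Type*} [MeasurableSpace Ω] {P : Measure Ω}
    [IsProbabilityMeasure P] {X : ℕ → Ω → Plane} {lam : ℝ} (hlam : 0 < lam)
    (hX : IsHomogeneousPoissonProcess P X lam) :
    IsPoissonProcess P X (lam.toNNReal • volume) := by
  refine ⟨hX.measurable, fun B hB hμB => ?_, fun {ι} _ B hB disjoint_B => ?_⟩
  · have smul_apply : (lam.toNNReal • volume : Measure Plane) B = lam.toNNReal * volume B := rfl
    have measurable_N : Measurable fun ω => {i | X i ω ∈ B}.encard :=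
      measurable_encard_setOf fun i => hX.measurable i hB
    have hvB : volume B < ∞ := by
      rw [smul_apply] at hμB
      exact ENNReal.lt_top_of_mul_ne_top_right hμB.ne
        (ENNReal.coe_ne_zero.2 (Real.toNNReal_pos.2 hlam).ne')
    have := Measure.isProbabilityMeasure_map measurable_N.aemeasurable (μ := P)
    refine ext_of_natCast_singleton fun k => ?_
    have cast_preimage : ((↑) : ℕ → ℕ∞) ⁻¹' {(k : ℕ∞)} = {k} := by ext; simp
    rw [Measure.map_apply measurable_N .of_discrete, Measure.map_apply .of_discrete .of_discrete,
      cast_preimage, smul_apply, ENNReal.toNNReal_mul, ENNReal.toNNReal_coe,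
      ← hX.poisson B hB hvB k]
    rfl
  · have e := Finite.equivFin ι
    have indep_fin := hX.indep (Nat.card ι) (B ∘ e.symm) (fun j => hB _) fun j l hjl =>
      disjoint_B (e.symm.injective.ne hjl)
    have indep_reindexed := indep_fin.precomp e.injective
    simpa only [pointCount, Function.comp_apply, Equiv.symm_apply_apply] using indep_reindexed

section GammaDistribution

variable {a r : ℝ}

lemma measurable_gammaPDF (a r : ℝ) : Measurable (gammaPDF a r) :=
  (measurable_gammaPDFReal a r).ennreal_ofReal

lemma ae_pos_gammaMeasure (a r : ℝ) : ∀ᵐ s ∂gammaMeasure a r, 0 < s := by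
  rw [gammaMeasure, ae_withDensity_iff (measurable_gammaPDF a r)]
  filter_upwards [Measure.ae_ne volume (0 : ℝ)] with s s_ne_zero pdf_ne_zero
  exact (not_lt.1 fun hs => pdf_ne_zero (gammaPDF_of_neg hs)).lt_of_ne' s_ne_zero

lemma lintegral_rpow_gammaMeasure {p : ℝ} (ha : 0 < a) (hr : 0 < r) (hap : 0 < a + p) :
    ∫⁻ s, ENNReal.ofReal (s ^ p) ∂gammaMeasure a r =
      ENNReal.ofReal (Real.Gamma (a + p) / (r ^ p * Real.Gamma a)) := by
  have pdf_shift : ∀ᵐ s : ℝ, gammaPDF a r s * ENNReal.ofReal (s ^ p) =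
      ENNReal.ofReal (Real.Gamma (a + p) / (r ^ p * Real.Gamma a)) * gammaPDF (a + p) r s := by
    filter_upwards [Measure.ae_ne volume (0 : ℝ)] with s s_ne_zero
    rcases s_ne_zero.lt_or_gt with hs | hs
    · rw [gammaPDF_of_neg hs, gammaPDF_of_neg hs, zero_mul, mul_zero]
    · rw [gammaPDF_of_nonneg hs.le, gammaPDF_of_nonneg hs.le, ← ENNReal.ofReal_mul (by positivity),
        ← ENNReal.ofReal_mul (by positivity), Real.rpow_add hr,
        show a + p - 1 = (a - 1) + p by ring, Real.rpow_add hs]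
      congr 1
      field_simp
  rw [gammaMeasure, lintegral_withDensity_eq_lintegral_mul _
    (measurable_gammaPDF a r) (by fun_prop)]
  simp only [Pi.mul_apply]
  rw [lintegral_congr_ae pdf_shift,
    lintegral_const_mul _ (measurable_gammaPDF _ r),
    lintegral_gammaPDF_eq_one hap hr, mul_one]

lemma hasDerivAt_sum_exp_neg_mul_pow_div_factorial (k : ℕ) (s : ℝ) :
    HasDerivAt (fun s => ∑ j ∈ Finset.range (k + 1), Real.exp (-s) * s ^ j / j.factorial)
      (-(Real.exp (-s) * s ^ k / k.factorial)) s := by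
  have exp_deriv : HasDerivAt (fun s : ℝ => Real.exp (-s)) (-Real.exp (-s)) s := by
    simpa using (hasDerivAt_neg s).exp
  induction k with
  | zero => simpa using exp_deriv
  | succ k ih =>
    simp only [Finset.sum_range_succ _ (k + 1)]
    refine (ih.add ((exp_deriv.mul (hasDerivAt_pow (k + 1) s)).div_const _)).congr_deriv ?_
    rw [Nat.factorial_succ]
    push_cast
    field_simp
    ring

lemma poissonMeasure_Ici (r : ℝ≥0) (k : ℕ) :
    poissonMeasure r (Set.Ici k) = ENNReal.ofReal
      (1 - ∑ j ∈ Finset.range k, Real.exp (-r) * r ^ j / j.factorial) := by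
  rw [← ofReal_measureReal, ← Set.compl_Iio, probReal_compl_eq_one_sub measurableSet_Iio]
  simp only [← poissonMeasure_real_singleton, sum_measureReal_singleton, Finset.coe_range]

lemma gammaMeasure_Iic_eq_poissonMeasure_Ici (k : ℕ) (r : ℝ≥0) :
    gammaMeasure (k + 1) 1 (Set.Iic r) = poissonMeasure r (Set.Ici (k + 1)) := by
  have gammaPDF_eq (s : ℝ) (hs : 0 ≤ s) :
      gammaPDF (k + 1) 1 s = ENNReal.ofReal (Real.exp (-s) * s ^ k / k.factorial) := by
    rw [gammaPDF_of_nonneg hs, Real.Gamma_nat_eq_factorial, add_sub_cancel_right,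
      Real.rpow_natCast, Real.one_rpow, one_mul]
    ring_nf
  have continuous_pdf : Continuous fun s : ℝ => Real.exp (-s) * s ^ k / k.factorial := by fun_prop
  have integral_pdf : ∫ s in (0 : ℝ)..r, Real.exp (-s) * s ^ k / k.factorial =
      1 - ∑ j ∈ Finset.range (k + 1), Real.exp (-r) * r ^ j / j.factorial := by
    have hasDerivAt_tail (s : ℝ) : HasDerivAt
        (fun s => -∑ j ∈ Finset.range (k + 1), Real.exp (-s) * s ^ j / j.factorial)
        (Real.exp (-s) * s ^ k / k.factorial) s := by
      simpa only [neg_neg] using (hasDerivAt_sum_exp_neg_mul_pow_div_factorial k s).fun_neg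
    have sum_zero :
        ∑ j ∈ Finset.range (k + 1), Real.exp (-(0 : ℝ)) * 0 ^ j / j.factorial = 1 := by
      simp [Finset.sum_range_succ']
    rw [intervalIntegral.integral_eq_sub_of_hasDerivAt (fun s _ => hasDerivAt_tail s)
      (continuous_pdf.intervalIntegrable _ _), sum_zero]
    ring
  calc gammaMeasure (k + 1) 1 (Set.Iic r)
      = ∫⁻ s in Set.Icc 0 (r : ℝ), gammaPDF (k + 1) 1 s := by
        rw [gammaMeasure, withDensity_apply _ measurableSet_Iic,
          lintegral_Iic_eq_lintegral_Iio_add_Icc _ r.coe_nonneg,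
          lintegral_gammaPDF_of_nonpos le_rfl, zero_add]
    _ = ∫⁻ s in Set.Icc 0 (r : ℝ), ENNReal.ofReal (Real.exp (-s) * s ^ k / k.factorial) :=
        setLIntegral_congr_fun measurableSet_Icc fun s hs => gammaPDF_eq s hs.1
    _ = ENNReal.ofReal (∫ s in (0 : ℝ)..r, Real.exp (-s) * s ^ k / k.factorial) := by
        rw [intervalIntegral.integral_of_le r.coe_nonneg, ← integral_Icc_eq_integral_Ioc,
          ofReal_integral_eq_lintegral_ofReal continuous_pdf.integrableOn_Icc]
        filter_upwards [ae_restrict_mem measurableSet_Icc] with s hs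
        have := hs.1
        positivity
    _ = poissonMeasure r (Set.Ici (k + 1)) := by rw [integral_pdf, poissonMeasure_Ici]

/- With `Γₖ` the `k`-th point of a unit-rate Poisson process on `[0, ∞)`, the event that
`c t ^ (-1/β)` is at least `Γₖ` reads `t ≤ c ^ β Γₖ ^ (-β)`, so the integral over `t` is the mean of
the latter. -/
lemma setLIntegral_poissonMeasure_Ici {c β : ℝ} {k : ℕ} (hc : 0 < c) (hβ : 0 < β) (hβk : β < k) :
    ∫⁻ t in Set.Ioi (0 : ℝ), poissonMeasure (c * t ^ (-β⁻¹)).toNNReal (Set.Ici k) =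
      ENNReal.ofReal (c ^ β * (Real.Gamma (k - β) / Real.Gamma k)) := by
  have k_pos : (0 : ℝ) < k := hβ.trans hβk
  have tail_eq (t : ℝ) (ht : t ∈ Set.Ioi 0) :
      poissonMeasure (c * t ^ (-β⁻¹)).toNNReal (Set.Ici k) =
        gammaMeasure k 1 {s | t ≤ c ^ β * s ^ (-β)} := by
    obtain ⟨l, rfl⟩ := Nat.exists_eq_succ_of_ne_zero (Nat.cast_pos.1 k_pos).ne'
    have ht : 0 < t := ht
    have cast_toNNReal : ((c * t ^ (-β⁻¹)).toNNReal : ℝ) = c * t ^ (-β⁻¹) :=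
      Real.coe_toNNReal _ (by positivity)
    rw [Nat.succ_eq_add_one, ← gammaMeasure_Iic_eq_poissonMeasure_Ici, cast_toNNReal, Nat.cast_succ]
    refine measure_congr ?_
    filter_upwards [ae_pos_gammaMeasure (l + 1) 1] with s hs
    refine propext ?_
    change s ≤ c * t ^ (-β⁻¹) ↔ t ≤ c ^ β * s ^ (-β)
    rw [Real.rpow_neg ht.le, Real.rpow_neg hs.le, ← div_eq_mul_inv, ← div_eq_mul_inv,
      le_div_iff₀ (by positivity), le_div_iff₀ (by positivity), mul_comm s, ← le_div_iff₀ hs,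
      Real.rpow_inv_le_iff_of_pos ht.le (by positivity) hβ, Real.div_rpow hc.le hs.le,
      le_div_iff₀ (by positivity)]
  rw [setLIntegral_congr_fun measurableSet_Ioi tail_eq, ← lintegral_eq_lintegral_meas_le]
  · simp only [ENNReal.ofReal_mul (Real.rpow_nonneg hc.le β)]
    rw [lintegral_const_mul _ (by fun_prop),
      lintegral_rpow_gammaMeasure k_pos one_pos (by linarith), Real.one_rpow, one_mul,
      sub_eq_add_neg]
  · filter_upwards [ae_pos_gammaMeasure k 1] with s hs
    positivity
  · fun_prop

end GammaDistribution

section BetaFunction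

variable {a b : ℝ}

lemma setLIntegral_rpow_mul_one_sub_rpow (ha : 0 < a) (hb : 0 < b) :
    ∫⁻ u in Set.Ioo (0 : ℝ) 1, ENNReal.ofReal (u ^ (a - 1) * (1 - u) ^ (b - 1)) =
      ENNReal.ofReal (beta a b) := by
  have h := lintegral_betaPDF_eq_one ha hb
  have beta_pos := beta_pos ha hb
  simp only [lintegral_betaPDF, mul_assoc, ENNReal.ofReal_mul (one_div_pos.2 beta_pos).le] at h
  rw [lintegral_const_mul _ (by fun_prop), one_div, ENNReal.ofReal_inv_of_pos beta_pos] at h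
  rw [← ENNReal.mul_right_inj (a := (ENNReal.ofReal (beta a b))⁻¹) (by simp)
    (by simp [beta_pos]), h, ENNReal.inv_mul_cancel (by simp [beta_pos]) (by simp)]

lemma tsum_beta_add_natCast (ha : 0 < a) (hb : 1 < b) :
    ∑' j : ℕ, ENNReal.ofReal (beta (a + j) b) = ENNReal.ofReal (beta a (b - 1)) := by
  have geometric_series : ∀ u ∈ Set.Ioo (0 : ℝ) 1,
      ∑' j : ℕ, ENNReal.ofReal (u ^ (a + j - 1) * (1 - u) ^ (b - 1)) =
        ENNReal.ofReal (u ^ (a - 1) * (1 - u) ^ (b - 1 - 1)) := by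
    rintro u ⟨hu0, hu1⟩
    have one_sub_pos : 0 < 1 - u := sub_pos.2 hu1
    have summand (j : ℕ) : u ^ (a + j - 1) * (1 - u) ^ (b - 1) =
        u ^ (a - 1) * (1 - u) ^ (b - 1) * u ^ j := by
      rw [show a + j - 1 = a - 1 + j by ring, Real.rpow_add_natCast hu0.ne']
      ring
    simp only [summand]
    rw [← ENNReal.ofReal_tsum_of_nonneg (fun j => by positivity)
      ((summable_geometric_of_lt_one hu0.le hu1).mul_left _), tsum_mul_left,
      tsum_geometric_of_lt_one hu0.le hu1, Real.rpow_sub_one one_sub_pos.ne' (b - 1)]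
    congr 1
    ring
  calc ∑' j : ℕ, ENNReal.ofReal (beta (a + j) b)
      = ∑' j : ℕ, ∫⁻ u in Set.Ioo (0 : ℝ) 1,
          ENNReal.ofReal (u ^ (a + j - 1) * (1 - u) ^ (b - 1)) := tsum_congr fun j =>
        (setLIntegral_rpow_mul_one_sub_rpow (by positivity) (by positivity)).symm
    _ = ∫⁻ u in Set.Ioo (0 : ℝ) 1, ENNReal.ofReal (u ^ (a - 1) * (1 - u) ^ (b - 1 - 1)) := by
        rw [← lintegral_tsum fun j => by fun_prop]
        exact setLIntegral_congr_fun measurableSet_Ioo geometric_series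
    _ = ENNReal.ofReal (beta a (b - 1)) := setLIntegral_rpow_mul_one_sub_rpow ha (sub_pos.2 hb)

lemma tsum_Gamma_sub_div_Gamma {x b : ℝ} (hb : 1 < b) (hbx : b < x) :
    ∑' j : ℕ, ENNReal.ofReal (Real.Gamma (x + j - b) / Real.Gamma (x + j)) =
      ENNReal.ofReal (Real.Gamma (x - b) / ((b - 1) * Real.Gamma (x - 1))) := by
  have := Real.Gamma_pos_of_pos (zero_lt_one.trans hb)
  have gamma_rec : Real.Gamma b = (b - 1) * Real.Gamma (b - 1) := by
    rw [← Real.Gamma_add_one (sub_pos.2 hb).ne', sub_add_cancel]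
  have ratio_eq_beta (j : ℕ) : ENNReal.ofReal (Real.Gamma (x + j - b) / Real.Gamma (x + j)) =
      ENNReal.ofReal (beta (x - b + j) b) * ENNReal.ofReal (Real.Gamma b)⁻¹ := by
    rw [← ENNReal.ofReal_mul' (by positivity), beta, show x - b + j + b = x + j by ring,
      show x + j - b = x - b + j by ring]
    congr 1
    field_simp
  simp only [ratio_eq_beta]
  rw [ENNReal.tsum_mul_right, tsum_beta_add_natCast (sub_pos.2 hbx) hb,
    ← ENNReal.ofReal_mul' (by positivity), beta, show x - b + (b - 1) = x - 1 by ring, gamma_rec]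
  have := Real.Gamma_pos_of_pos (sub_pos.2 hb)
  congr 1
  field_simp

end BetaFunction

section PolarAngle

lemma measurable_toIcoMod {p : ℝ} (hp : 0 < p) (a : ℝ) : Measurable (toIcoMod hp a) := by
  have toIcoMod_eq (b : ℝ) : toIcoMod hp a b = a + Int.fract ((b - a) / p) * p :=
    toIcoMod_eq_add_fract_mul hp a b
  rw [funext toIcoMod_eq]
  fun_prop

lemma measurable_polarAngle : Measurable polarAngle := by
  have measurable_toComplex : Measurable fun v : Plane => (⟨v 0, v 1⟩ : ℂ) :=
    Complex.measurableEquivRealProd.symm.measurable.comp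
      (f := fun v : Plane => (v 0, v 1)) (by fun_prop)
  exact (measurable_toIcoMod _ _).comp (Complex.measurable_arg.comp measurable_toComplex)

lemma polarAngle_le_two_pi (v : Plane) : polarAngle v ≤ 2 * Real.pi := by
  have h := toIcoMod_lt_right Real.two_pi_pos 0 (Complex.arg ⟨v 0, v 1⟩)
  rw [zero_add] at h
  exact h.le

lemma polarAngle_repr_polarCoord_symm {p : ℝ × ℝ} (hp : p ∈ polarCoord.target) :
    polarAngle (Complex.orthonormalBasisOneI.repr (Complex.polarCoord.symm p)) =
      toIcoMod Real.two_pi_pos 0 p.2 := by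
  obtain ⟨p_fst_pos, p_snd_mem⟩ : 0 < p.1 ∧ p.2 ∈ Set.Ioo (-Real.pi) Real.pi := hp
  have toComplex_repr (z : ℂ) : (⟨Complex.orthonormalBasisOneI.repr z 0,
      Complex.orthonormalBasisOneI.repr z 1⟩ : ℂ) = z := Complex.ext (by simp) (by simp)
  rw [polarAngle, toComplex_repr, Complex.polarCoord_symm_apply, Complex.ofReal_cos,
    Complex.ofReal_sin,
    Complex.arg_mul_cos_add_sin_mul_I p_fst_pos (Set.Ioo_subset_Ioc_self p_snd_mem)]

lemma setLIntegral_Ioo_neg_pi_pi_toIcoMod (g : ℝ → ℝ≥0∞) :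
    ∫⁻ θ in Set.Ioo (-Real.pi) Real.pi, g (toIcoMod Real.two_pi_pos 0 θ) =
      ∫⁻ θ in Set.Ico 0 (2 * Real.pi), g θ := by
  calc ∫⁻ θ in Set.Ioo (-Real.pi) Real.pi, g (toIcoMod Real.two_pi_pos 0 θ)
      = ∫⁻ θ in Set.Ioc (-Real.pi) (-Real.pi + 2 * Real.pi), g (toIcoMod Real.two_pi_pos 0 θ) := by
        rw [show -Real.pi + 2 * Real.pi = Real.pi by ring]
        exact setLIntegral_congr Ioo_ae_eq_Ioc
    _ = ∫⁻ θ in Set.Ioc 0 (0 + 2 * Real.pi), g (toIcoMod Real.two_pi_pos 0 θ) := by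
        refine (isAddFundamentalDomain_Ioc Real.two_pi_pos _).setLIntegral_eq
          (isAddFundamentalDomain_Ioc Real.two_pi_pos _) _ ?_
        rintro ⟨_, m, rfl⟩ θ
        change g (toIcoMod _ 0 (m • (2 * Real.pi) + θ)) = _
        rw [toIcoMod_zsmul_add]
    _ = ∫⁻ θ in Set.Ico 0 (2 * Real.pi), g (toIcoMod Real.two_pi_pos 0 θ) := by
        rw [zero_add]
        exact setLIntegral_congr Ico_ae_eq_Ioc.symm
    _ = ∫⁻ θ in Set.Ico 0 (2 * Real.pi), g θ :=
        setLIntegral_congr_fun measurableSet_Ico fun θ hθ => by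
          rw [(toIcoMod_eq_self Real.two_pi_pos).2 (by rwa [zero_add])]

lemma lintegral_norm_polarAngle {F : ℝ × ℝ → ℝ≥0∞} (hF : Measurable F) :
    ∫⁻ v : Plane, F (‖v‖, polarAngle v) =
      ∫⁻ r in Set.Ioi (0 : ℝ), ENNReal.ofReal r * ∫⁻ θ in Set.Ico 0 (2 * Real.pi), F (r, θ) := by
  have measurable_angle := measurable_toIcoMod Real.two_pi_pos 0
  have measurable_section (r : ℝ) : Measurable fun θ => F (r, toIcoMod Real.two_pi_pos 0 θ) := by
    fun_prop
  calc ∫⁻ v : Plane, F (‖v‖, polarAngle v)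
      = ∫⁻ p in polarCoord.target, ENNReal.ofReal p.1 *
          F (p.1, toIcoMod Real.two_pi_pos 0 p.2) := by
        rw [← Complex.orthonormalBasisOneI.repr.measurePreserving.lintegral_comp
          (f := fun v : Plane => F (‖v‖, polarAngle v))
          (hF.comp (measurable_norm.prodMk measurable_polarAngle)),
          ← Complex.lintegral_comp_polarCoord_symm]
        refine setLIntegral_congr_fun polarCoord.open_target.measurableSet fun p hp => ?_
        rw [smul_eq_mul, polarAngle_repr_polarCoord_symm hp, LinearIsometryEquiv.norm_map,
          Complex.norm_polarCoord_symm, abs_of_pos (show 0 < p.1 from hp.1)]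
    _ = ∫⁻ r in Set.Ioi (0 : ℝ), ENNReal.ofReal r *
          ∫⁻ θ in Set.Ioo (-Real.pi) Real.pi, F (r, toIcoMod Real.two_pi_pos 0 θ) := by
        rw [polarCoord_target, Measure.volume_eq_prod, ← Measure.prod_restrict,
          lintegral_prod _ (by fun_prop)]
        exact lintegral_congr fun r => lintegral_const_mul (ENNReal.ofReal r) (measurable_section r)
    _ = ∫⁻ r in Set.Ioi (0 : ℝ), ENNReal.ofReal r * ∫⁻ θ in Set.Ico 0 (2 * Real.pi), F (r, θ) := by
        congr! 3 with r
        exact setLIntegral_Ioo_neg_pi_pi_toIcoMod fun θ => F (r, θ)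

lemma setLIntegral_polarAngle_le {φ : ℝ} (hφ : φ ≤ 2 * Real.pi) {f : ℝ → ℝ≥0∞}
    (hf : Measurable f) : ∫⁻ v in {v : Plane | polarAngle v ≤ φ}, f ‖v‖ =
      ENNReal.ofReal φ * ∫⁻ r in Set.Ioi (0 : ℝ), ENNReal.ofReal r * f r := by
  have volume_angles : volume (Set.Iic φ ∩ Set.Ico 0 (2 * Real.pi)) = ENNReal.ofReal φ := by
    rw [measure_congr ((ae_eq_refl (Set.Iic φ)).inter Ico_ae_eq_Icc), Set.inter_comm,
      ← Set.Ici_inter_Iic, Set.inter_assoc, Set.Iic_inter_Iic, min_eq_right hφ, Set.Ici_inter_Iic,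
      Real.volume_Icc, sub_zero]
  let F (p : ℝ × ℝ) : ℝ≥0∞ := (Set.Iic φ).indicator (fun _ => f p.1) p.2
  have measurable_F : Measurable F :=
    (hf.comp measurable_fst).indicator (measurable_snd measurableSet_Iic)
  calc ∫⁻ v in {v : Plane | polarAngle v ≤ φ}, f ‖v‖
      = ∫⁻ v : Plane, F (‖v‖, polarAngle v) :=
        (lintegral_indicator (measurable_polarAngle measurableSet_Iic) _).symm
    _ = ∫⁻ r in Set.Ioi (0 : ℝ), ENNReal.ofReal r * (f r * ENNReal.ofReal φ) := by
        rw [lintegral_norm_polarAngle measurable_F]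
        simp only [F, lintegral_indicator_const measurableSet_Iic,
          Measure.restrict_apply measurableSet_Iic, volume_angles]
    _ = ENNReal.ofReal φ * ∫⁻ r in Set.Ioi (0 : ℝ), ENNReal.ofReal r * f r := by
        rw [← lintegral_const_mul _ (by fun_prop)]
        exact lintegral_congr fun r => by ring

lemma lintegral_comp_norm_plane {f : ℝ → ℝ≥0∞} (hf : Measurable f) :
    ∫⁻ v : Plane, f ‖v‖ =
      ENNReal.ofReal (2 * Real.pi) * ∫⁻ r in Set.Ioi (0 : ℝ), ENNReal.ofReal r * f r := by
  have sector_eq_univ : {v | polarAngle v ≤ 2 * Real.pi} = Set.univ :=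
    Set.eq_univ_of_forall polarAngle_le_two_pi
  rw [← setLIntegral_polarAngle_le le_rfl hf, sector_eq_univ, Measure.restrict_univ]

end PolarAngle

section KthLargest

lemma volume_pos_ofReal_mem_of_isLowerSet {D : Set ℝ≥0∞} (hD : IsLowerSet D) :
    volume {t : ℝ | 0 < t ∧ ENNReal.ofReal t ∈ D} = sSup D := by
  refine le_antisymm ?_ (le_of_forall_lt fun c c_lt => ?_)
  · rcases eq_or_ne (sSup D) ∞ with sSup_eq | sSup_ne_top
    · exact sSup_eq ▸ le_top
    calc volume {t : ℝ | 0 < t ∧ ENNReal.ofReal t ∈ D}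
        ≤ volume (Set.Ioc 0 (sSup D).toReal) := measure_mono fun t ht =>
          ⟨ht.1, (ENNReal.ofReal_le_iff_le_toReal sSup_ne_top).1 (le_sSup ht.2)⟩
      _ = sSup D := by rw [Real.volume_Ioc, sub_zero, ENNReal.ofReal_toReal sSup_ne_top]
  · obtain ⟨b, c_lt_b, b_lt⟩ := exists_between c_lt
    obtain ⟨d, hd, b_lt_d⟩ := lt_sSup_iff.1 b_lt
    have b_ne_top : b ≠ ∞ := (b_lt.trans_le le_top).ne
    calc c < b := c_lt_b
      _ = volume (Set.Ioc 0 b.toReal) := by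
          rw [Real.volume_Ioc, sub_zero, ENNReal.ofReal_toReal b_ne_top]
      _ ≤ volume {t : ℝ | 0 < t ∧ ENNReal.ofReal t ∈ D} := measure_mono fun t ht =>
          ⟨ht.1, hD ((ENNReal.ofReal_le_of_le_toReal ht.2).trans b_lt_d.le) hd⟩

lemma kthLargest_eq_volume (S : Set ℕ) (a : ℕ → ℝ≥0∞) (k : ℕ) :
    kthLargest S a k =
      volume {t : ℝ | 0 < t ∧ (k : ℕ∞) ≤ {i ∈ S | ENNReal.ofReal t ≤ a i}.encard} := by
  have isLowerSet_levels : IsLowerSet {t : ℝ≥0∞ | (k : ℕ∞) ≤ {i ∈ S | t ≤ a i}.encard} :=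
    fun s t hts hs => le_trans (b := {i ∈ S | s ≤ a i}.encard) hs
      (Set.encard_mono fun i hi => ⟨hi.1, hts.trans hi.2⟩)
  exact (volume_pos_ofReal_mem_of_isLowerSet isLowerSet_levels).symm

end KthLargest

section Moments

variable {E : Type*} [MeasurableSpace E] {μ : Measure E}

lemma integral_pos_of_ae_pos [NeZero μ] {f : E → ℝ} (hf : Integrable f μ)
    (hpos : ∀ᵐ x ∂μ, 0 < f x) : 0 < ∫ x, f x ∂μ := by
  refine (integral_nonneg_of_ae (hpos.mono fun _ hx => hx.le)).lt_of_ne' fun integral_eq_zero => ?_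
  have ae_zero :=
    (integral_eq_zero_iff_of_nonneg_ae (hpos.mono fun _ hx => hx.le) hf).1 integral_eq_zero
  obtain ⟨_, pos, eq_zero⟩ := (hpos.and ae_zero).exists
  exact pos.ne' eq_zero

lemma integrable_rpow_of_le_one [IsFiniteMeasure μ] {f : E → ℝ} {s : ℝ} (hf : Integrable f μ)
    (hpos : ∀ᵐ x ∂μ, 0 < f x) (hs : 0 ≤ s) (hs1 : s ≤ 1) :
    Integrable (fun x => f x ^ s) μ := by
  refine ((integrable_const (1 : ℝ)).add hf).mono'
    (hf.aemeasurable.pow_const s).aestronglyMeasurable ?_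
  filter_upwards [hpos] with x hx
  rw [Real.norm_of_nonneg (by positivity), Pi.add_apply]
  rcases le_total (f x) 1 with hx1 | hx1
  · linarith [Real.rpow_le_one hx.le hx1 hs]
  · linarith [Real.rpow_le_self_of_one_le hx1 hs1]

end Moments

section Interference

variable {Ω : Type*} [MeasurableSpace Ω] {P : Measure Ω} [IsProbabilityMeasure P]
  {X : ℕ → Ω → Plane} {h : ℕ → Ω → ℝ} {ν : Measure ℝ} [IsProbabilityMeasure ν]
  {lam α φ : ℝ} {rx : Plane}

lemma IsHomogeneousPoissonProcess.hasPoissonLaplace_marked (hlam : 0 < lam)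
    (hX : IsHomogeneousPoissonProcess P X lam) (hh : IsChannelGain P X h ν) :
    HasPoissonLaplace P (fun i ω => (X i ω, h i ω))
      ((lam.toNNReal • volume : Measure Plane).prod ν) :=
  (hX.isPoissonProcess hlam).hasPoissonLaplace.marked hh.measurable hh.law hh.indep hh.indep_nodes

lemma measurable_interferencePower (α : ℝ) (rx : Plane) :
    Measurable fun p : Plane × ℝ => interferencePower α rx p.1 p.2 := by
  unfold interferencePower
  fun_prop

lemma setLIntegral_Ici_mul_rpow_neg (hα : 2 < α) {R : ℝ} (hR : 0 < R) :
    ∫⁻ r in Set.Ici R, ENNReal.ofReal r * ENNReal.ofReal (r ^ (-α)) =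
      ENNReal.ofReal (R ^ (2 - α) / (α - 2)) := by
  have integrand_eq : ∀ r ∈ Set.Ioi R,
      ENNReal.ofReal r * ENNReal.ofReal (r ^ (-α)) = ENNReal.ofReal (r ^ (1 - α)) := fun r hr => by
    have r_pos : 0 < r := hR.trans hr
    rw [← ENNReal.ofReal_mul r_pos.le, sub_eq_add_neg, Real.rpow_add r_pos, Real.rpow_one]
  rw [← setLIntegral_congr Ioi_ae_eq_Ici, setLIntegral_congr_fun measurableSet_Ioi integrand_eq,
    ← ofReal_integral_eq_lintegral_ofReal (integrableOn_Ioi_rpow_of_lt (by linarith) hR),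
    integral_Ioi_rpow_of_lt (by linarith) hR, neg_div, ← div_neg,
    show -(1 - α + 1) = α - 2 by ring, show 1 - α + 1 = 2 - α by ring]
  filter_upwards [ae_restrict_mem measurableSet_Ioi] with r hr
  exact Real.rpow_nonneg (hR.trans hr).le _

lemma lintegral_outsideInterference (hlam : 0 < lam) (hα : 2 < α)
    (hX : IsHomogeneousPoissonProcess P X lam) (hh : IsChannelGain P X h ν)
    (hpos : ∀ᵐ t ∂ν, 0 < t) (hint : Integrable (fun t : ℝ => t) ν) {R : ℝ} (hR : 0 < R) :
    ∫⁻ ω, outsideInterference α rx R (fun i => X i ω) (fun i => h i ω) ∂P =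
      ENNReal.ofReal (2 * Real.pi * lam * (∫ t, t ∂ν) * R ^ (2 - α) / (α - 2)) := by
  classical
  let pathLoss : ℝ → ℝ≥0∞ := (Set.Ici R).indicator fun r => ENNReal.ofReal (r ^ (-α))
  have measurable_pathLoss : Measurable pathLoss :=
    Measurable.indicator (by fun_prop) measurableSet_Ici
  have power_eq (p : Plane × ℝ) : (if p.1 ∈ Metric.ball rx R then 0 else
      interferencePower α rx p.1 p.2) = pathLoss ‖p.1 - rx‖ * ENNReal.ofReal p.2 := by
    by_cases hp : R ≤ ‖p.1 - rx‖
    · rw [if_neg (by rwa [mem_ball_iff_norm, not_lt]), interferencePower, norm_sub_rev,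
        ENNReal.ofReal_mul' (by positivity), mul_comm]
      simp only [pathLoss, Set.indicator_of_mem (Set.mem_Ici.2 hp)]
    · rw [if_pos (by rwa [mem_ball_iff_norm, ← not_le])]
      simp only [pathLoss, Set.indicator_of_notMem (Set.notMem_Ici.2 (not_le.1 hp)), zero_mul]
  have : 0 ≤ ∫ t, t ∂ν := integral_nonneg_of_ae (hpos.mono fun t ht => ht.le)
  have radial_integral : ∫⁻ r in Set.Ioi (0 : ℝ), ENNReal.ofReal r * pathLoss r =
      ENNReal.ofReal (R ^ (2 - α) / (α - 2)) := by
    simp only [pathLoss, ← Set.indicator_mul_right]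
    rw [setLIntegral_indicator measurableSet_Ici,
      Set.inter_eq_left.2 (Set.Ici_subset_Ioi.2 hR), setLIntegral_Ici_mul_rpow_neg hα hR]
  have campbell := (hX.hasPoissonLaplace_marked hlam hh).lintegral_tsum
    (f := fun p => pathLoss ‖p.1 - rx‖ * ENNReal.ofReal p.2) (by fun_prop)
  simp only [outsideInterference, power_eq (_, _)]
  rw [campbell, lintegral_prod_mul (f := fun y => pathLoss ‖y - rx‖) (by fun_prop) (by fun_prop),
    lintegral_smul_measure,
    lintegral_sub_right_eq_self (fun v => pathLoss ‖v‖) rx,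
    lintegral_comp_norm_plane measurable_pathLoss, radial_integral,
    ← ofReal_integral_eq_lintegral_ofReal hint (hpos.mono fun t ht => ht.le)]
  change ENNReal.ofReal lam * _ * _ = _
  have := sub_pos.2 hα
  rw [← ENNReal.ofReal_mul (by positivity), ← ENNReal.ofReal_mul hlam.le,
    ← ENNReal.ofReal_mul (by positivity)]
  ring_nf

/-- The pairs of a position and a channel gain for which a node is received within the reception
angle `φ` with interference power at least `t`. -/
def strongNodes (α φ : ℝ) (rx : Plane) (t : ℝ) : Set (Plane × ℝ) :=
  {p | polarAngle (p.1 - rx) ≤ φ ∧ ENNReal.ofReal t ≤ interferencePower α rx p.1 p.2}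

lemma measurableSet_setOf_mem_strongNodes {E : Type*} [MeasurableSpace E] {p : E → Plane × ℝ}
    {t : E → ℝ} (hp : Measurable p) (ht : Measurable t) :
    MeasurableSet {x | p x ∈ strongNodes α φ rx (t x)} :=
  (measurableSet_le (measurable_polarAngle.comp (by fun_prop)) measurable_const).inter
    (measurableSet_le (by fun_prop) ((measurable_interferencePower α rx).comp hp))

lemma measurableSet_le_encard_strongNodes {E : Type*} [MeasurableSpace E]
    {p : ℕ → E → Plane × ℝ} {t : E → ℝ} (hp : ∀ i, Measurable (p i)) (ht : Measurable t) (k : ℕ) :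
    MeasurableSet {x | (k : ℕ∞) ≤ {i | p i x ∈ strongNodes α φ rx (t x)}.encard} :=
  measurable_encard_setOf (fun i => measurableSet_setOf_mem_strongNodes (hp i) ht)
    (MeasurableSet.of_discrete (s := Set.Ici (k : ℕ∞)))

lemma measurableSet_strongNodes (α φ : ℝ) (rx : Plane) (t : ℝ) :
    MeasurableSet (strongNodes α φ rx t) :=
  measurableSet_setOf_mem_strongNodes measurable_id measurable_const

lemma volume_sector (hφ : φ ≤ 2 * Real.pi) {ρ : ℝ} (hρ : 0 ≤ ρ) :
    volume {v : Plane | polarAngle v ≤ φ ∧ ‖v‖ ∈ Set.Ioc 0 ρ} =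
      ENNReal.ofReal (φ * (ρ ^ 2 / 2)) := by
  have radial_integral : ∫⁻ r in Set.Ioc 0 ρ, ENNReal.ofReal r = ENNReal.ofReal (ρ ^ 2 / 2) := by
    rw [← ofReal_integral_eq_lintegral_ofReal (f := fun r : ℝ => r)
      (continuous_id.integrableOn_Ioc (a := 0) (b := ρ))
      ((ae_restrict_mem measurableSet_Ioc).mono fun r hr => hr.1.le),
      ← intervalIntegral.integral_of_le hρ, integral_id]
    ring_nf
  calc volume {v : Plane | polarAngle v ≤ φ ∧ ‖v‖ ∈ Set.Ioc 0 ρ}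
      = ∫⁻ v in {v | polarAngle v ≤ φ}, (Set.Ioc 0 ρ).indicator 1 ‖v‖ := by
        have measurable_annulus : MeasurableSet {v : Plane | ‖v‖ ∈ Set.Ioc 0 ρ} :=
          measurable_norm measurableSet_Ioc
        rw [Set.ofPred_and, Set.inter_comm, ← Measure.restrict_apply measurable_annulus,
          ← lintegral_indicator_one measurable_annulus]
        rfl
    _ = ENNReal.ofReal φ * ∫⁻ r in Set.Ioi (0 : ℝ), (Set.Ioc 0 ρ).indicator ENNReal.ofReal r := by
        rw [setLIntegral_polarAngle_le hφ (measurable_one.indicator measurableSet_Ioc)]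
        simp only [← Set.indicator_mul_right, Pi.one_apply, mul_one]
    _ = ENNReal.ofReal (φ * (ρ ^ 2 / 2)) := by
        rw [setLIntegral_indicator measurableSet_Ioc,
          Set.inter_eq_left.2 Set.Ioc_subset_Ioi_self, radial_integral,
          ENNReal.ofReal_mul' (by positivity)]

lemma ofReal_le_interferencePower_iff (hα : 0 < α) {g t : ℝ} (hg : 0 < g) (ht : 0 < t)
    {y : Plane} : ENNReal.ofReal t ≤ interferencePower α rx y g ↔
      ‖y - rx‖ ∈ Set.Ioc 0 ((g / t) ^ α⁻¹) := by
  rw [interferencePower, ENNReal.ofReal_le_ofReal_iff (by positivity), norm_sub_rev]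
  rcases (norm_nonneg (y - rx)).eq_or_lt' with norm_zero | norm_pos
  · simp [norm_zero, Real.zero_rpow (neg_ne_zero.2 hα.ne'), ht]
  · rw [Set.mem_Ioc, and_iff_right norm_pos, Real.rpow_neg norm_pos.le, ← div_eq_mul_inv,
      le_div_iff₀ (by positivity), mul_comm, ← le_div_iff₀ ht,
      Real.le_rpow_inv_iff_of_pos norm_pos.le (by positivity) hα]

lemma volume_strongNodes_section (hα : 0 < α) (hφ : φ ≤ 2 * Real.pi) {g t : ℝ} (hg : 0 < g)
    (ht : 0 < t) : volume {y | (y, g) ∈ strongNodes α φ rx t} =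
      ENNReal.ofReal (φ * (g ^ (2 / α) * t ^ (-(2 / α)) / 2)) := by
  have section_eq : {y | (y, g) ∈ strongNodes α φ rx t} = (fun y => y + -rx) ⁻¹'
      {v | polarAngle v ≤ φ ∧ ‖v‖ ∈ Set.Ioc 0 ((g / t) ^ α⁻¹)} := by
    ext y
    simp only [strongNodes, Set.mem_ofPred_eq, ofReal_le_interferencePower_iff hα hg ht,
      Set.mem_preimage, sub_eq_add_neg]
  have radius_sq : ((g / t) ^ α⁻¹) ^ 2 = g ^ (2 / α) * t ^ (-(2 / α)) := by
    rw [← Real.rpow_mul_natCast (by positivity), Nat.cast_ofNat, inv_mul_eq_div,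
      Real.div_rpow hg.le ht.le, Real.rpow_neg ht.le, div_eq_mul_inv]
  rw [section_eq, measure_preimage_add_right, volume_sector hφ (by positivity), radius_sq]

lemma measure_strongNodes (hlam : 0 < lam) (hα : 0 < α) (hφ : φ ≤ 2 * Real.pi)
    (hpos : ∀ᵐ g ∂ν, 0 < g) (hint : Integrable (fun g : ℝ => g ^ (2 / α)) ν) {t : ℝ}
    (ht : 0 < t) :
    (lam.toNNReal • volume : Measure Plane).prod ν (strongNodes α φ rx t) =
      ENNReal.ofReal (lam * (φ * gainMoment ν (2 / α) / 2) * t ^ (-(2 / α))) := by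
  have section_measure : ∀ᵐ g ∂ν, (lam.toNNReal • volume : Measure Plane)
      ((fun y => (y, g)) ⁻¹' strongNodes α φ rx t) =
        ENNReal.ofReal (lam * (φ * t ^ (-(2 / α)) / 2)) * ENNReal.ofReal (g ^ (2 / α)) := by
    filter_upwards [hpos] with g hg
    change ENNReal.ofReal lam * volume {y | (y, g) ∈ strongNodes α φ rx t} = _
    rw [volume_strongNodes_section hα hφ hg ht, ← ENNReal.ofReal_mul hlam.le,
      ← ENNReal.ofReal_mul' (by positivity)]
    ring_nf
  have moment_nonneg : 0 ≤ gainMoment ν (2 / α) :=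
    integral_nonneg_of_ae (hpos.mono fun g hg => Real.rpow_nonneg hg.le _)
  rw [Measure.prod_apply_symm (measurableSet_strongNodes α φ rx t),
    lintegral_congr_ae section_measure, lintegral_const_mul _ (by fun_prop),
    ← ofReal_integral_eq_lintegral_ofReal hint (hpos.mono fun g hg => Real.rpow_nonneg hg.le _),
    ← gainMoment, ← ENNReal.ofReal_mul' moment_nonneg]
  ring_nf

lemma gainMoment_pos {s : ℝ} (hpos : ∀ᵐ g ∂ν, 0 < g)
    (hint : Integrable (fun g : ℝ => g ^ s) ν) : 0 < gainMoment ν s :=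
  integral_pos_of_ae_pos hint (hpos.mono fun _ hg => Real.rpow_pos_of_pos hg s)

lemma dominantInterference_eq_lintegral (x : ℕ → Plane) (g : ℕ → ℝ) (k : ℕ) :
    dominantInterference α φ rx x g k =
      ∫⁻ t in Set.Ioi (0 : ℝ), {t | (k : ℕ∞) ≤
        {i | (x i, g i) ∈ strongNodes α φ rx t}.encard}.indicator 1 t := by
  have measurableSet_levels :
      MeasurableSet {t | (k : ℕ∞) ≤ {i | (x i, g i) ∈ strongNodes α φ rx t}.encard} :=
    measurableSet_le_encard_strongNodes (fun _ => measurable_const) measurable_id k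
  rw [lintegral_indicator_one measurableSet_levels, Measure.restrict_apply measurableSet_levels,
    Set.inter_comm, dominantInterference, kthLargest_eq_volume]
  rfl

lemma measurable_dominantInterference (hX : ∀ i, Measurable (X i)) (hh : ∀ i, Measurable (h i))
    (k : ℕ) :
    Measurable fun ω => dominantInterference α φ rx (fun i => X i ω) (fun i => h i ω) k := by
  have measurable_marked (i : ℕ) : Measurable fun q : Ω × ℝ => (X i q.1, h i q.1) := by fun_prop
  simp only [dominantInterference_eq_lintegral]
  exact Measurable.lintegral_prod_right' (f := Set.indicator _ 1) (measurable_one.indicator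
    (measurableSet_le_encard_strongNodes measurable_marked measurable_snd k))

lemma lintegral_dominantInterference (hlam : 0 < lam) (hα : 0 < α) (hφ : 0 < φ)
    (hφ' : φ ≤ 2 * Real.pi) (hX : IsHomogeneousPoissonProcess P X lam)
    (hh : IsChannelGain P X h ν) (hpos : ∀ᵐ g ∂ν, 0 < g)
    (hint : Integrable (fun g : ℝ => g ^ (2 / α)) ν) {k : ℕ} (hk : α / 2 < k) :
    ∫⁻ ω, dominantInterference α φ rx (fun i => X i ω) (fun i => h i ω) k ∂P =
      ENNReal.ofReal ((lam * (φ * gainMoment ν (2 / α) / 2)) ^ (α / 2) *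
        (Real.Gamma (k - α / 2) / Real.Gamma k)) := by
  have moment_pos := gainMoment_pos hpos hint
  have measurable_node (i : ℕ) : Measurable fun ω => (X i ω, h i ω) :=
    (hX.measurable i).prodMk (hh.measurable i)
  have measurableSet_levels := measurableSet_le_encard_strongNodes (α := α) (φ := φ) (rx := rx)
    (fun i => (measurable_node i).comp measurable_fst) measurable_snd k
  simp only [dominantInterference_eq_lintegral]
  rw [lintegral_lintegral_swap (f := fun ω t => {t | (k : ℕ∞) ≤
      {i | (X i ω, h i ω) ∈ strongNodes α φ rx t}.encard}.indicator 1 t)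
    (measurable_one.indicator measurableSet_levels).aemeasurable,
    ← setLIntegral_poissonMeasure_Ici (by positivity) (by positivity) hk]
  refine setLIntegral_congr_fun measurableSet_Ioi fun t ht => ?_
  have measure_eq := measure_strongNodes (rx := rx) hlam hα hφ' hpos hint ht
  rw [inv_div, ← ENNReal.toNNReal_coe (Real.toNNReal _), ← ENNReal.ofReal, ← measure_eq,
    ← (hX.hasPoissonLaplace_marked hlam hh).measure_le_encard
      (measurableSet_strongNodes α φ rx t) (measure_eq ▸ ENNReal.ofReal_ne_top) k,
    ← lintegral_indicator_one
      (measurableSet_le_encard_strongNodes measurable_node measurable_const k)]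
  rfl

lemma lintegral_partialInterference (hlam : 0 < lam) (hα : 2 < α) (hφ : 0 < φ)
    (hφ' : φ ≤ 2 * Real.pi) {n : ℕ} (hnα : α / 2 < n + 1)
    (hX : IsHomogeneousPoissonProcess P X lam) (hh : IsChannelGain P X h ν)
    (hpos : ∀ᵐ g ∂ν, 0 < g) (hint : Integrable (fun g : ℝ => g ^ (2 / α)) ν) :
    ∫⁻ ω, partialInterference α φ rx n (fun i => X i ω) (fun i => h i ω) ∂P =
      ENNReal.ofReal ((lam * (φ * gainMoment ν (2 / α) / 2)) ^ (α / 2) *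
        (realPochhammer n (1 - α / 2) / (α / 2 - 1))) := by
  have α_pos : 0 < α := by linarith
  have moment_pos := gainMoment_pos hpos hint
  have scale_nonneg : 0 ≤ (lam * (φ * gainMoment ν (2 / α) / 2)) ^ (α / 2) := by positivity
  have lintegral_dominant (j : ℕ) :
      ∫⁻ ω, dominantInterference α φ rx (fun i => X i ω) (fun i => h i ω) (n + 1 + j) ∂P =
        ENNReal.ofReal ((lam * (φ * gainMoment ν (2 / α) / 2)) ^ (α / 2)) *
          ENNReal.ofReal (Real.Gamma (n + 1 + j - α / 2) / Real.Gamma (n + 1 + j)) := by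
    have : (0 : ℝ) ≤ j := j.cast_nonneg
    rw [lintegral_dominantInterference hlam α_pos hφ hφ' hX hh hpos hint (by push_cast; linarith),
      ENNReal.ofReal_mul scale_nonneg]
    push_cast
    rfl
  simp only [partialInterference]
  rw [lintegral_tsum fun j => (measurable_dominantInterference hX.measurable hh.measurable
      _).aemeasurable]
  simp only [lintegral_dominant]
  rw [ENNReal.tsum_mul_left, tsum_Gamma_sub_div_Gamma (by linarith) hnα,
    ← ENNReal.ofReal_mul scale_nonneg, realPochhammer, add_sub_cancel_right, add_sub_assoc,
    div_div, mul_comm (α / 2 - 1)]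

end Interference

section EquivalentRadius

lemma realPochhammer_pos {n : ℕ} {s : ℝ} (hn : 0 < n) (hns : 0 < n + s) :
    0 < realPochhammer n s :=
  div_pos (Real.Gamma_pos_of_pos hns) (Real.Gamma_pos_of_pos (by positivity))

variable {ν : Measure ℝ} {lam α φ : ℝ} {n : ℕ}

lemma equivalentRadius_pos (hlam : 0 < lam) (hφ : 0 < φ) (moment_pos : 0 < gainMoment ν (2 / α))
    (mean_pos : 0 < ∫ t, t ∂ν) (pochhammer_pos : 0 < realPochhammer n (1 - α / 2)) :
    0 < equivalentRadius α φ lam ν n := by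
  unfold equivalentRadius
  positivity

lemma equivalentRadius_rpow (hlam : 0 < lam) (hα : 2 < α) (hφ : 0 < φ)
    (moment_pos : 0 < gainMoment ν (2 / α)) (mean_pos : 0 < ∫ t, t ∂ν)
    (pochhammer_pos : 0 < realPochhammer n (1 - α / 2)) :
    Real.pi * lam * (∫ t, t ∂ν) * equivalentRadius α φ lam ν n ^ (2 - α) =
      (lam * (φ * gainMoment ν (2 / α) / 2)) ^ (α / 2) * realPochhammer n (1 - α / 2) := by
  have two_sub_ne_zero : 2 - α ≠ 0 := (sub_neg.2 hα).ne
  have exponent_mul : α / (2 * (2 - α)) * (2 - α) = α / 2 := by field_simp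
  have lam_rpow : lam * lam ^ (-(1 / 2) * (2 - α)) = lam ^ (α / 2) := by
    rw [← Real.rpow_one_add' hlam.le (by linarith)]
    ring_nf
  unfold equivalentRadius
  rw [Real.mul_rpow (by positivity) (by positivity), Real.mul_rpow (by positivity) (by positivity),
    ← Real.rpow_mul (by positivity), ← Real.rpow_mul (by positivity), ← Real.rpow_mul hlam.le,
    exponent_mul, one_div_mul_cancel two_sub_ne_zero, Real.rpow_one,
    Real.mul_rpow hlam.le (by positivity), ← lam_rpow]
  field_simp

end EquivalentRadius

theorem mainTheorem6 {Ω : Type*} [MeasurableSpace Ω] (P : Measure Ω) [IsProbabilityMeasure P]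
    (X : ℕ → Ω → Plane) (h : ℕ → Ω → ℝ) (ν : Measure ℝ) [IsProbabilityMeasure ν]
    (lam α φ : ℝ) (n : ℕ) (rx : Plane)
    (hlam : 0 < lam) (hα : 2 < α) (hφ : 0 < φ) (hφ' : φ ≤ 2 * Real.pi)
    (hn : 1 ≤ n) (hnα : α < 2 * ((n : ℝ) + 1))
    (hX : IsHomogeneousPoissonProcess P X lam)
    (hh : IsChannelGain P X h ν)
    (hpos : ∀ᵐ t ∂ν, 0 < t) (hint : Integrable (fun t : ℝ => t) ν) :
    (∀ R : ℝ, 0 < R →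
      ∫⁻ ω, outsideInterference α rx R (fun i => X i ω) (fun i => h i ω) ∂P =
        ENNReal.ofReal (2 * Real.pi * lam * (∫ t, t ∂ν) * R ^ (2 - α) / (α - 2))) ∧
    0 < equivalentRadius α φ lam ν n ∧
    ∫⁻ ω, partialInterference α φ rx n (fun i => X i ω) (fun i => h i ω) ∂P =
      ∫⁻ ω, outsideInterference α rx (equivalentRadius α φ lam ν n)
        (fun i => X i ω) (fun i => h i ω) ∂P := by
  have moment_integrable : Integrable (fun t : ℝ => t ^ (2 / α)) ν :=
    integrable_rpow_of_le_one hint hpos (by positivity) ((div_le_one (by linarith)).2 hα.le)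
  have moment_pos := gainMoment_pos hpos moment_integrable
  have mean_pos := integral_pos_of_ae_pos hint hpos
  have pochhammer_pos : 0 < realPochhammer n (1 - α / 2) := realPochhammer_pos hn (by linarith)
  have radius_pos := equivalentRadius_pos hlam hφ moment_pos mean_pos pochhammer_pos
  have outside_mean (R : ℝ) (hR : 0 < R) :=
    lintegral_outsideInterference (rx := rx) hlam hα hX hh hpos hint hR
  refine ⟨outside_mean, radius_pos, ?_⟩
  rw [outside_mean _ radius_pos,
    lintegral_partialInterference hlam hα hφ hφ' (by linarith) hX hh hpos moment_integrable,
    ← mul_div_assoc, ← equivalentRadius_rpow hlam hα hφ moment_pos mean_pos pochhammer_pos,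
    show α / 2 - 1 = (α - 2) / 2 by ring, div_div_eq_mul_div]
  ring_nf
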